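/- Let $n\ge 1$, $q=2^{2n+1}$, $\omega=2^{n+1}$, and let $F$ be the field with $q$ elements. For $x,y\in F$ put $f(x,y)=x^{\omega+2}+xy+y^{\omega}$, and let $G$ be the group, under matrix multiplication, of all matrices $$M(r;a,b)=\begin{pmatrix}1&f(a,b)&a&b\\0&r^{\omega+2}&0&0\\0&(a^{\omega+1}+b)r&r&a^{\omega}r\\0&ar^{\omega+1}&0&r^{\omega+1}\end{pmatrix}\qquad(r\in F^*,\ a,b\in F),$$ acting on the points of $PG(3,q)$ by right multiplication on row vectors. (It is the stabiliser of the point $[0,1,0,0]$ in a representation of the Suzuki group $Sz(q)$.) For a point $u=[x_0,x_1,x_2,x_3]$ let $c=x_0x_1+x_2x_3$ and let $\pi(u)$ be the line spanned by $(0,c^{\omega/2},x_0^\omega,x_2^\omega)$, $(c^{\omega/2},0,x_3^\omega,x_1^\omega)$, $(x_0^\omega,x_3^\omega,0,c^{\omega/2})$ and $(x_2^\omega,x_1^\omega,c^{\omega/2},0)$; this is a polarity of the symplectic generalised quadrangle $W(q)$. Let $A(q)$ be the graph on the points in which distinct $u,v$ are adjacent if $u\in\pi(v)$ (equivalently $v\in\pi(u)$).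 Let $O_5$ be the set of points that are not of any of the forms $[1,f(x,y),x,y]$, $[0,x,1,y]$, $[0,x,0,1]$, $[0,1,0,0]$ with $x,y\in F$, and let $B(q)$ be the subgraph of $A(q)$ induced by $O_5$. For $m\ge 3$ let $c_m$ be the smallest number of elements of an inverse-closed set $X\not\ni 0$ in $\mathbb Z_m$ for which the Cayley graph $C(\mathbb Z_m,X)$ has diameter $2$. Then: 1. $|G|=q^2(q-1)$. The maps $\theta_1(r)=M(r;r+1,r+1)$ and $\theta_2(r)=M(r;0,1+r^{\omega+1})$ are injective homomorphisms $F^*\to G$, and their images are the stabilisers in $G$ of the points $[1,1,1,1]$ and $[0,1,1,0]$, respectively. 2. There is an inverse-closed set $X\subset F^*\setminus\{1\}$ with $|X|=c_{q-1}$ for which $C(F^*,X)$ has diameter $2$. For every such $X$ let $S^*=S\cup S_1\cup S_2\cup S_3$, where $S$ is the set of all $g\in G$ for which $[1,1,0,0]\,g$ is a neighbour of $[1,1,0,0]$ in $B(q)$, $S_1=\theta_1(X)$, $S_2=\theta_2(X)$, and $S_3$ consists of $M(1;1,1)$, $M(1;1,0)$ and their inverses. Then $S^*$ is closed under inverses and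 does not contain the identity, and the Cayley graph $C(G,S^*)$, of order $q^2(q-1)$, is regular of degree $q+2c_{q-1}+1$ and has diameter $3$. -/

import Mathlib

open scoped LinearAlgebra.Projectivization

section CayleyGraphs

/-- `X` is a connection set of an undirected loopless Cayley graph: it is closed under inverses
and does not contain the identity. -/
def IsCayleySet {G : Type*} [Group G] (X : Set G) : Prop :=
  1 ∉ X ∧ ∀ x ∈ X, x⁻¹ ∈ X

/-- The number `c_m`: the smallest size of a connection set `X` of an (undirected) Cayley graph of
diameter `2` of the cyclic group `ℤ/m`. -/
noncomputable def minCyclicDegree (m : ℕ) : ℕ :=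
  sInf {k : ℕ | ∃ X : Set (ZMod m), 0 ∉ X ∧ (∀ x ∈ X, -x ∈ X) ∧ X.ncard = k ∧
    (SimpleGraph.addCayley X).ediam = 2}

end CayleyGraphs

section SuzukiMatrices

variable {F : Type*} [Field F]

/-- The exponent `ω = 2^(n+1)`. -/
def om (n : ℕ) : ℕ := 2 ^ (n + 1)

/-- `f(x,y) = x^(ω+2) + x y + y^ω`. -/
def suzF (n : ℕ) (x y : F) : F := x ^ (om n + 2) + x * y + y ^ om n

/-- The matrix `M(r;a,b)`. -/
def suzMatrix (n : ℕ) (r a b : F) : Matrix (Fin 4) (Fin 4) F :=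
  !![1, suzF n a b, a, b;
     0, r ^ (om n + 2), 0, 0;
     0, (a ^ (om n + 1) + b) * r, r, a ^ om n * r;
     0, a * r ^ (om n + 1), 0, r ^ (om n + 1)]

theorem suzMatrix_det_ne_zero (n : ℕ) (r : Fˣ) (a b : F) :
    (suzMatrix n (r : F) a b).det ≠ 0 := by
  have h : (suzMatrix n (r : F) a b).det =
      (r : F) ^ (om n + 2) * (r : F) * (r : F) ^ (om n + 1) := by
    simp [suzMatrix, Matrix.det_succ_row_zero, Fin.sum_univ_succ, Fin.succAbove]
    try ring
  rw [h]
  simp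

/-- `M(r;a,b)` as an invertible matrix. -/
noncomputable def suzGL (n : ℕ) (r : Fˣ) (a b : F) : GL (Fin 4) F :=
  Matrix.GeneralLinearGroup.mkOfDetNeZero (suzMatrix n (r : F) a b)
    (suzMatrix_det_ne_zero n r a b)

variable {n : ℕ}

theorem two_eq_zero_of_card (hF : Nat.card F = 2 ^ (2 * n + 1)) : (2 : F) = 0 := by
  have hfin : Finite F := Nat.finite_of_card_ne_zero (by rw [hF]; positivity)
  have h : ((Nat.card F : ℕ) : F) = 0 := by
    let _ := Fintype.ofFinite F
    rw [Nat.card_eq_fintype_card]; exact Nat.cast_card_eq_zero F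
  rw [hF] at h
  push_cast at h
  exact pow_eq_zero_iff (by omega) |>.1 h

theorem add_pow_om (hF : Nat.card F = 2 ^ (2 * n + 1)) (x y : F) :
    (x + y) ^ om n = x ^ om n + y ^ om n := by
  have _h : CharP F 2 := CharTwo.of_one_ne_zero_of_two_eq_zero one_ne_zero (two_eq_zero_of_card hF)
  exact add_pow_char_pow x y 2 (n + 1)

theorem pow_om_pow_om (hF : Nat.card F = 2 ^ (2 * n + 1)) (x : F) :
    (x ^ om n) ^ om n = x ^ 2 := by
  have hfin : Finite F := Nat.finite_of_card_ne_zero (by rw [hF]; positivity)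
  let _ := Fintype.ofFinite F
  have h : x ^ 2 ^ (2 * n + 1) = x := by
    rw [← hF, Nat.card_eq_fintype_card]; exact FiniteField.pow_card x
  calc (x ^ om n) ^ om n = (x ^ 2 ^ (2 * n + 1)) ^ 2 := by
        rw [← pow_mul, ← pow_mul]; congr 1; simp only [om]; ring
    _ = x ^ 2 := by rw [h]

theorem suzGL_mul (hF : Nat.card F = 2 ^ (2 * n + 1)) (r s : Fˣ) (a b c d : F) :
    suzGL n r a b * suzGL n s c d =
      suzGL n (r * s) (a * s + c) (b * s ^ (om n + 1) + d + a * c ^ om n * s) := by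
  have h2 := two_eq_zero_of_card hF
  apply Units.ext
  change suzMatrix n (r : F) a b * suzMatrix n (s : F) c d = suzMatrix n ((r * s : Fˣ) : F) _ _
  have hc := pow_om_pow_om hF c
  have hs := pow_om_pow_om hF (s : F)
  ext i j
  fin_cases i <;> fin_cases j <;>
    simp [suzMatrix, suzF, Matrix.mul_apply, Fin.sum_univ_four, pow_add, add_pow_om hF, mul_pow,
      hc, hs] <;> grind

theorem suzGL_one : suzGL n (1 : Fˣ) 0 0 = 1 := by
  apply Units.ext
  change suzMatrix n ((1 : Fˣ) : F) 0 0 = 1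
  ext i j
  fin_cases i <;> fin_cases j <;> simp [suzMatrix, suzF, om]

theorem suzGL_mul_inv (hF : Nat.card F = 2 ^ (2 * n + 1)) (r : Fˣ) (a b : F) :
    suzGL n r a b * suzGL n r⁻¹ (-(a * (r⁻¹ : Fˣ)))
      (-(b * ((r⁻¹ : Fˣ) : F) ^ (om n + 1) + a * (-(a * (r⁻¹ : Fˣ))) ^ om n * (r⁻¹ : Fˣ))) = 1 := by
  rw [suzGL_mul hF, ← suzGL_one (F := F) (n := n)]
  congr 1
  · simp
  · ring
  · ring

/-- The group `G` of all matrices `M(r;a,b)` with `r ∈ F^*` and `a, b ∈ F`,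
where `F` is the field with `2^(2n+1)` elements. -/
def suzGroup (hF : Nat.card F = 2 ^ (2 * n + 1)) : Subgroup (GL (Fin 4) F) where
  carrier := {A | ∃ (r : Fˣ) (a b : F), A = suzGL n r a b}
  mul_mem' := by
    rintro _ _ ⟨r, a, b, rfl⟩ ⟨s, c, d, rfl⟩
    exact ⟨_, _, _, suzGL_mul hF r s a b c d⟩
  one_mem' := ⟨1, 0, 0, suzGL_one.symm⟩
  inv_mem' := by
    rintro _ ⟨r, a, b, rfl⟩
    exact ⟨_, _, _, inv_eq_of_mul_eq_one_right (suzGL_mul_inv hF r a b)⟩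

/-- `M(r;a,b)` as an element of `G`. -/
noncomputable def suzM (hF : Nat.card F = 2 ^ (2 * n + 1)) (r : Fˣ) (a b : F) : suzGroup hF :=
  ⟨suzGL n r a b, r, a, b, rfl⟩

theorem suzM_mul (hF : Nat.card F = 2 ^ (2 * n + 1)) (r s : Fˣ) (a b c d : F) :
    suzM hF r a b * suzM hF s c d =
      suzM hF (r * s) (a * s + c) (b * s ^ (om n + 1) + d + a * c ^ om n * s) :=
  Subtype.ext (suzGL_mul hF r s a b c d)

/-- `θ₁ : r ↦ M(r; r+1, r+1)`. -/
noncomputable def theta1 (hF : Nat.card F = 2 ^ (2 * n + 1)) : Fˣ →* suzGroup hF :=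
  MonoidHom.mk' (fun r => suzM hF r ((r : F) + 1) ((r : F) + 1)) (by
    intro r s
    have h2 := two_eq_zero_of_card hF
    have h1 := add_pow_om hF (s : F) 1
    rw [suzM_mul, h1]
    congr 1
    · push_cast; grind
    · push_cast; rw [pow_succ, one_pow]; grind)

/-- `θ₂ : r ↦ M(r; 0, 1 + r^(ω+1))`. -/
noncomputable def theta2 (hF : Nat.card F = 2 ^ (2 * n + 1)) : Fˣ →* suzGroup hF :=
  MonoidHom.mk' (fun r => suzM hF r 0 (1 + (r : F) ^ (om n + 1))) (by
    intro r s
    have h2 := two_eq_zero_of_card hF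
    rw [suzM_mul]
    congr 1
    · simp
    · push_cast; rw [mul_pow]; grind)

end SuzukiMatrices

section Geometry

variable {F : Type*} [Field F] {n : ℕ}

/-- The points of the generalised quadrangle `W(q)`: all points of `PG(3,q)`. -/
abbrev WPoint (F : Type*) [Field F] : Type _ := ℙ F (Fin 4 → F)

/-- The span of the four vectors which define the line `π[x]`. -/
def polarSpan (n : ℕ) (x : Fin 4 → F) : Submodule F (Fin 4 → F) :=
  let c : F := (x 0 * x 1 + x 2 * x 3) ^ (2 ^ n)
  Submodule.span F
    {![0, c, x 0 ^ om n, x 2 ^ om n], ![c, 0, x 3 ^ om n, x 1 ^ om n],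
      ![x 0 ^ om n, x 3 ^ om n, 0, c], ![x 2 ^ om n, x 1 ^ om n, c, 0]}

theorem polarSpan_smul (n : ℕ) (t : F) (ht : t ≠ 0) (x : Fin 4 → F) :
    polarSpan n (t • x) = polarSpan n x := by
  have hu : IsUnit (t ^ om n) := (pow_ne_zero _ ht).isUnit
  have hc : (t * x 0 * (t * x 1) + t * x 2 * (t * x 3)) ^ (2 ^ n) =
      t ^ om n * (x 0 * x 1 + x 2 * x 3) ^ (2 ^ n) := by
    have : t ^ om n = (t ^ 2) ^ (2 ^ n) := by
      rw [← pow_mul]; congr 1; simp only [om]; ring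
    rw [this, ← mul_pow]; congr 1; ring
  rw [polarSpan, polarSpan]
  simp only [Pi.smul_apply, smul_eq_mul, hc, mul_pow]
  conv_rhs => rw [← Submodule.span_smul_eq_of_isUnit _ _ hu]
  congr 1
  simp [← Set.image_smul, Set.image_insert_eq]

/-- The line `π(u)` of `W(q)` (as a two-dimensional subspace) which the polarity assigns to the
point `u`. -/
def polarLine (n : ℕ) (u : WPoint F) : Submodule F (Fin 4 → F) :=
  Projectivization.lift (fun v : {v : Fin 4 → F // v ≠ 0} => polarSpan n v.1) (by
    rintro ⟨a, ha⟩ ⟨b, hb⟩ t h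
    have h' : a = t • b := h
    have ht : t ≠ 0 := by
      rintro rfl
      exact ha (by simpa using h')
    simp only [h']
    exact polarSpan_smul n t ht b) u

/-- The polarity graph `A(q)`: distinct points `u`, `v` are adjacent if `u ∈ π(v)`, equivalently
`v ∈ π(u)`. -/
def polarityGraph (F : Type*) [Field F] (n : ℕ) : SimpleGraph (WPoint F) :=
  SimpleGraph.fromRel fun u v => u.submodule ≤ polarLine n v

/-- The point `[1,x,y,z]`. -/
def ptOne (x y z : F) : WPoint F :=
  Projectivization.mk F ![1, x, y, z] fun h => one_ne_zero (congrFun h 0)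

/-- The point `[0,x,1,y]`. -/
def ptTwo (x y : F) : WPoint F :=
  Projectivization.mk F ![0, x, 1, y] fun h => one_ne_zero (congrFun h 2)

/-- The point `[0,x,0,1]`. -/
def ptThree (x : F) : WPoint F :=
  Projectivization.mk F ![0, x, 0, 1] fun h => one_ne_zero (congrFun h 3)

/-- The point `[0,1,0,0]`. -/
def ptFour : WPoint F :=
  Projectivization.mk F ![0, 1, 0, 0] fun h => one_ne_zero (congrFun h 1)

/-- The orbits `O₁`, ..., `O₄` of `G` on the points of `W(q)`; the first one consists of the points
of the Suzuki-Tits ovoid other than `[0,1,0,0]`. -/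
def orbit1 (F : Type*) [Field F] (n : ℕ) : Set (WPoint F) :=
  {p | ∃ x y : F, p = ptOne (suzF n x y) x y}

def orbit2 (F : Type*) [Field F] : Set (WPoint F) := {p | ∃ x y : F, p = ptTwo x y}

def orbit3 (F : Type*) [Field F] : Set (WPoint F) := {p | ∃ x : F, p = ptThree x}

def orbit4 (F : Type*) [Field F] : Set (WPoint F) := {ptFour}

/-- The regular orbit `O₅` of `G`: the complement of the other four orbits. -/
def orbit5 (F : Type*) [Field F] (n : ℕ) : Set (WPoint F) :=
  (orbit1 F n ∪ orbit2 F ∪ orbit3 F ∪ orbit4 F)ᶜ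

/-- The point `[x]A`, the image of the point `[x]` under right multiplication by `A`. -/
def actRight (p : WPoint F) (A : GL (Fin 4) F) : WPoint F :=
  Projectivization.map (Matrix.vecMulLinear (A : Matrix (Fin 4) (Fin 4) F))
    (Matrix.vecMul_injective_of_isUnit A.isUnit) p

/-- The stabiliser in `G` of a point. -/
def suzStab (hF : Nat.card F = 2 ^ (2 * n + 1)) (p : WPoint F) : Set (suzGroup hF) :=
  {g | actRight p (g : GL (Fin 4) F) = p}

/-- The set `S`: the elements `g` of `G` which carry the base vertex `u = [1,1,0,0]` to a neighbour
of `u` in `B(q)`, the subgraph of `A(q)` induced by `O₅`. -/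
def genS (hF : Nat.card F = 2 ^ (2 * n + 1)) : Set (suzGroup hF) :=
  {g | actRight (ptOne 1 0 0) (g : GL (Fin 4) F) ∈ orbit5 F n ∧
    (polarityGraph F n).Adj (ptOne 1 0 0) (actRight (ptOne 1 0 0) (g : GL (Fin 4) F))}

/-- The set `S₃` of `M₁ = M(1;1,1)`, `M₂ = M(1;1,0)` and their inverses. -/
noncomputable def genS3 (hF : Nat.card F = 2 ^ (2 * n + 1)) : Set (suzGroup hF) :=
  {suzM hF 1 1 1, (suzM hF 1 1 1)⁻¹, suzM hF 1 1 0, (suzM hF 1 1 0)⁻¹}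

/-- `S^* = S ∪ S₁ ∪ S₂ ∪ S₃` with `S₁ = θ₁(X)` and `S₂ = θ₂(X)`. -/
noncomputable def genSStar (hF : Nat.card F = 2 ^ (2 * n + 1)) (X : Set Fˣ) : Set (suzGroup hF) :=
  genS hF ∪ theta1 hF '' X ∪ theta2 hF '' X ∪ genS3 hF

/-- `X` is a connection set, of the smallest possible size, of a Cayley graph of diameter `2` of
the cyclic group `F^*`. -/
def IsOptimalX (X : Set Fˣ) : Prop :=
  IsCayleySet X ∧ X.ncard = minCyclicDegree (Nat.card F - 1) ∧ (SimpleGraph.mulCayley X).ediam = 2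

end Geometry

/-! ### Distances and diameters in Cayley graphs. -/

section CayleyDistance

variable {V : Type*} {Γ : SimpleGraph V}

/-! Upper bound. Put u = [1,1,0,0] and v = [u]g with g = M(r;a,b). If u is not on π(v), the
quadrangle axiom gives a unique sequence u, p, w, v whose consecutive members are related by the
polarity. The line π(u) consists of the points [1,t,t,1] and [0,1,1,0]; all of them lie in O₅ except
[1,1,1,1] and [0,1,1,0]. When p and w are in O₅, the sequence writes g as a product of three
elements of S. If p is one of the two bad points, its stabiliser θᵢ(F^*) is used instead: some g
θᵢ(ρ) lies in S ∪ S₃ ∪ {1}, and ρ⁻¹ is a product of two elements of X ∪ {1}, so three factors again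
suffice. If w is the image under g of a bad point, the same argument applies to g⁻¹.

The proof is this argument in coordinates. With E = 1 + b and D = b + a^(ω+1) + r^(ω+1), the bad
cases are E = 0 and D^ω = (1+a)E (for p), D = 0 and E^ω = (r+a)D (for w). They are treated in
`exists_suzM_mul_theta2_mem` and `exists_suzM_mul_theta1_mem`, the generic case in
`exists_mul_mul_mem_genS`. Everything rests on x ↦ x^ω being an additive map whose square is x ↦ x².

Lower bound. Diameter 2 would force |G| ≤ (|S^*| + 1)², which the crude estimate c_(q-1) ≤ q - 4
rules out for q ≥ 8. -/

theorem exists_edist_le_one_of_edist_le_two {u v : V} (h : Γ.edist u v ≤ 2) :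
    ∃ w, Γ.edist u w ≤ 1 ∧ Γ.edist w v ≤ 1 := by
  obtain ⟨p, hp⟩ := SimpleGraph.exists_walk_of_edist_ne_top
    (ne_top_of_le_ne_top (by decide) h)
  have hlen : p.length ≤ 2 := by rw [← hp] at h; exact_mod_cast h
  cases p with
  | nil => exact ⟨u, by simp, by simp⟩
  | cons ha p =>
    refine ⟨_, SimpleGraph.edist_le_one_iff_adj_or_eq.2 (Or.inl ha), p.edist_le.trans ?_⟩
    rw [SimpleGraph.Walk.length_cons] at hlen
    exact_mod_cast (by omega : p.length ≤ 1)

variable {G : Type*} [Group G] {X : Set G}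

theorem IsCayleySet.adj_iff (hX : IsCayleySet X) {u v : G} :
    (SimpleGraph.mulCayley X).Adj u v ↔ u⁻¹ * v ∈ X := by
  rw [SimpleGraph.mulCayley_adj]
  constructor
  · rintro ⟨-, h | h⟩
    · exact h
    · simpa using hX.2 _ h
  · refine fun h => ⟨?_, Or.inl h⟩
    rintro rfl
    exact hX.1 (by simpa using h)

theorem IsCayleySet.edist_le_one_iff (hX : IsCayleySet X) {u v : G} :
    (SimpleGraph.mulCayley X).edist u v ≤ 1 ↔ u⁻¹ * v ∈ insert 1 X := by
  rw [SimpleGraph.edist_le_one_iff_adj_or_eq, hX.adj_iff, Set.mem_insert_iff, inv_mul_eq_one,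
    or_comm]

theorem IsCayleySet.ncard_neighborSet (hX : IsCayleySet X) (g : G) :
    ((SimpleGraph.mulCayley X).neighborSet g).ncard = X.ncard := by
  have h : (SimpleGraph.mulCayley X).neighborSet g = (g * ·) '' X := by
    ext v
    rw [SimpleGraph.mem_neighborSet, hX.adj_iff]
    exact ⟨fun h => ⟨_, h, by simp⟩, by rintro ⟨x, hx, rfl⟩; simpa using hx⟩
  rw [h, Set.ncard_image_of_injective _ (mul_right_injective g)]

theorem IsCayleySet.ediam_le_two_iff (hX : IsCayleySet X) :
    (SimpleGraph.mulCayley X).ediam ≤ 2 ↔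
      ∀ g : G, ∃ x ∈ insert 1 X, ∃ y ∈ insert 1 X, g = x * y := by
  rw [SimpleGraph.ediam_le_iff]
  constructor
  · intro h g
    obtain ⟨w, h1, h2⟩ := exists_edist_le_one_of_edist_le_two (h 1 g)
    rw [hX.edist_le_one_iff] at h1 h2
    exact ⟨_, h1, _, h2, by simp⟩
  · intro h u v
    obtain ⟨x, hx, y, hy, hg⟩ := h (u⁻¹ * v)
    have h1 := hX.edist_le_one_iff (u := u) (v := u * x) |>.2 (by simpa using hx)
    have h2 : (SimpleGraph.mulCayley X).edist (u * x) v ≤ 1 := by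
      rw [hX.edist_le_one_iff]
      have : (u * x)⁻¹ * v = y := by
        rw [inv_mul_eq_iff_eq_mul, mul_assoc, ← hg]; simp
      rwa [this]
    exact SimpleGraph.edist_triangle.trans ((add_le_add h1 h2).trans (by norm_num))

theorem IsCayleySet.ediam_le_three (hX : IsCayleySet X)
    (h : ∀ g : G, ∃ x ∈ insert 1 X, ∃ y ∈ insert 1 X, ∃ z ∈ insert 1 X, g = x * y * z) :
    (SimpleGraph.mulCayley X).ediam ≤ 3 := by
  refine SimpleGraph.ediam_le_of_edist_le fun u v => ?_
  obtain ⟨x, hx, y, hy, z, hz, hg⟩ := h (u⁻¹ * v)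
  have h1 := hX.edist_le_one_iff (u := u) (v := u * x) |>.2 (by simpa using hx)
  have h2 := hX.edist_le_one_iff (u := u * x) (v := u * x * y) |>.2 (by rwa [inv_mul_cancel_left])
  have h3 : (SimpleGraph.mulCayley X).edist (u * x * y) v ≤ 1 := by
    rw [hX.edist_le_one_iff]
    have : (u * x * y)⁻¹ * v = z := by
      rw [inv_mul_eq_iff_eq_mul, mul_assoc, mul_assoc, ← mul_assoc x, ← hg]; simp
    rwa [this]
  calc _ ≤ _ := SimpleGraph.edist_triangle (v := u * x)
    _ ≤ _ := add_le_add h1 (SimpleGraph.edist_triangle (v := u * x * y))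
    _ ≤ 1 + (1 + 1) := by gcongr
    _ = 3 := by norm_num

/-- Every group element is a product of two elements of X ∪ {1}, so there are at most as many
elements as such pairs. -/
theorem IsCayleySet.card_le_of_ediam_le_two [Finite G] (hX : IsCayleySet X)
    (h : (SimpleGraph.mulCayley X).ediam ≤ 2) : Nat.card G ≤ (X.ncard + 1) ^ 2 := by
  rw [hX.ediam_le_two_iff] at h
  have hsurj : Function.Surjective
      (fun p : (insert 1 X : Set G) × (insert 1 X : Set G) => (p.1 * p.2 : G)) := by
    intro g
    obtain ⟨x, hx, y, hy, rfl⟩ := h g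
    exact ⟨(⟨x, hx⟩, ⟨y, hy⟩), rfl⟩
  have := Nat.card_le_card_of_surjective _ hsurj
  rwa [Nat.card_prod, Nat.card_coe_set_eq, Set.ncard_insert_of_notMem hX.1, ← sq] at this

end CayleyDistance

/-! ### The number c_m, transported to an arbitrary cyclic group of order m. -/

section CyclicDegree

theorem SimpleGraph.Iso.ediam_le {V W : Type*} {Γ : SimpleGraph V} {Δ : SimpleGraph W}
    (e : Γ ≃g Δ) : Δ.ediam ≤ Γ.ediam := by
  refine SimpleGraph.ediam_le_of_edist_le fun u v => ?_
  refine le_trans ?_ (SimpleGraph.edist_le_ediam (u := e.symm u) (v := e.symm v))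
  rcases eq_or_ne (Γ.edist (e.symm u) (e.symm v)) ⊤ with h | h
  · exact h ▸ le_top
  · obtain ⟨p, hp⟩ := SimpleGraph.exists_walk_of_edist_ne_top h
    rw [← hp]
    have := ((p.map e.toHom).copy (e.apply_symm_apply u) (e.apply_symm_apply v)).edist_le
    simpa using this

theorem SimpleGraph.Iso.ediam_eq {V W : Type*} {Γ : SimpleGraph V} {Δ : SimpleGraph W}
    (e : Γ ≃g Δ) : Γ.ediam = Δ.ediam :=
  le_antisymm (ediam_le e.symm) (ediam_le e)

variable {C : Type*}

/-- If `c² ≠ 1`, `c³ ≠ 1` and `c⁴ ≠ 1`, then removing `1`, `c` and `c⁻¹` from a group leaves a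
connection set of diameter `2`. -/
theorem isCayleySet_compl_ediam [Group C] (c : C) (h2 : c ^ 2 ≠ 1) (h3 : c ^ 3 ≠ 1)
    (h4 : c ^ 4 ≠ 1) :
    IsCayleySet ({1, c, c⁻¹}ᶜ : Set C) ∧
      (SimpleGraph.mulCayley ({1, c, c⁻¹}ᶜ : Set C)).ediam = 2 := by
  have h1 : c ≠ 1 := by rintro rfl; simp at h2
  have hX : IsCayleySet ({1, c, c⁻¹}ᶜ : Set C) := by
    refine ⟨by simp, fun x hx => ?_⟩
    simp only [Set.mem_compl_iff, Set.mem_insert_iff, Set.mem_singleton_iff, not_or] at hx ⊢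
    refine ⟨by simpa using hx.1, fun h => hx.2.2 (by simp [← h]), fun h => hx.2.1 (by simpa using h)⟩
  have hc3 : c ^ 3 ∈ ({1, c, c⁻¹}ᶜ : Set C) := by
    simp only [Set.mem_compl_iff, Set.mem_insert_iff, Set.mem_singleton_iff, not_or]
    refine ⟨h3, fun h => h2 ?_, fun h => h4 ?_⟩
    · rw [pow_succ] at h; simpa using h
    · rw [pow_succ, h, inv_mul_cancel]
  have hc2 : c ^ 2 ∈ ({1, c, c⁻¹}ᶜ : Set C) := by
    simp only [Set.mem_compl_iff, Set.mem_insert_iff, Set.mem_singleton_iff, not_or]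
    refine ⟨h2, fun h => h1 ?_, fun h => h3 ?_⟩
    · rw [pow_succ] at h; simpa using h
    · rw [pow_succ, h, inv_mul_cancel]
  refine ⟨hX, le_antisymm (hX.ediam_le_two_iff.2 fun g => ?_) ?_⟩
  -- Only c and c⁻¹ need two factors: c = c³ · c⁻² and c⁻¹ = c⁻³ · c².
  · by_cases hg : g = c
    · exact ⟨_, Or.inr hc3, _, Or.inr (hX.2 _ hc2), by rw [hg]; group⟩
    by_cases hg' : g = c⁻¹
    · exact ⟨_, Or.inr (hX.2 _ hc3), _, Or.inr hc2, by rw [hg']; group⟩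
    · exact ⟨g, by simp only [Set.mem_insert_iff, Set.mem_compl_iff, Set.mem_singleton_iff]; tauto,
        1, by simp, by simp⟩
  · by_contra! h
    have h' := hX.edist_le_one_iff (u := 1) (v := c) |>.1
      (SimpleGraph.edist_le_ediam.trans (Order.le_of_lt_add_one (by rwa [one_add_one_eq_two])))
    simp [h1] at h'

variable [CommGroup C] {m : ℕ}

/-- The isomorphism of Cayley graphs induced by an isomorphism of `ℤ/m` with `C`. -/
def addCayleyIso (e : Multiplicative (ZMod m) ≃* C) (X : Set C) :
    SimpleGraph.addCayley ((fun i : ZMod m => e (.ofAdd i)) ⁻¹' X) ≃g SimpleGraph.mulCayley X where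
  toEquiv := Multiplicative.ofAdd.trans e.toEquiv
  map_rel_iff' := by
    intro u v
    simp [SimpleGraph.addCayley_adj, SimpleGraph.mulCayley_adj]

theorem minCyclicDegree_eq (e : Multiplicative (ZMod m) ≃* C) :
    minCyclicDegree m = sInf {k : ℕ | ∃ X : Set C, IsCayleySet X ∧ X.ncard = k ∧
      (SimpleGraph.mulCayley X).ediam = 2} := by
  rw [minCyclicDegree]
  congr 1
  ext k
  let f : ZMod m ≃ C := Multiplicative.ofAdd.trans e.toEquiv
  have hf : ∀ X : Set C, ((0 ∉ f ⁻¹' X ∧ (∀ x ∈ f ⁻¹' X, -x ∈ f ⁻¹' X) ∧ (f ⁻¹' X).ncard = k ∧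
      (SimpleGraph.addCayley (f ⁻¹' X)).ediam = 2) ↔
      IsCayleySet X ∧ X.ncard = k ∧ (SimpleGraph.mulCayley X).ediam = 2) := by
    intro X
    have h0 : f 0 = 1 := by simp [f]
    have hneg : ∀ x, f (-x) = (f x)⁻¹ := by simp [f]
    rw [Set.ncard_preimage_of_injective_subset_range f.injective (by simp),
      ← SimpleGraph.Iso.ediam_eq (addCayleyIso e X), IsCayleySet, and_assoc, Set.mem_preimage, h0]
    refine and_congr_right fun _ => and_congr ⟨fun h x hx => ?_, fun h x hx => ?_⟩ Iff.rfl
    · have := h (f.symm x) (by simpa using hx)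
      simpa [hneg] using this
    · simpa [hneg] using h _ hx
  constructor
  · rintro ⟨X, hX⟩
    refine ⟨f.symm ⁻¹' X, (hf _).1 ?_⟩
    have : f ⁻¹' (f.symm ⁻¹' X) = X := by ext; simp
    rwa [this]
  · rintro ⟨X, hX⟩
    exact ⟨f ⁻¹' X, (hf _).2 hX⟩

/-- The complement of {1, c, c⁻¹}, with c a generator, is an admissible set of size m - 3. It bounds
the infimum and also shows that it is attained, an infimum over the empty set being 0. -/
theorem exists_ncard_eq_minCyclicDegree (e : Multiplicative (ZMod m) ≃* C) (hm : 7 ≤ m) :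
    (∃ X : Set C, IsCayleySet X ∧ X.ncard = minCyclicDegree m ∧
      (SimpleGraph.mulCayley X).ediam = 2) ∧ minCyclicDegree m + 3 ≤ m := by
  have : NeZero m := ⟨by omega⟩
  have hpow : ∀ k : ℕ, k ≠ 0 → k < m → e (.ofAdd 1) ^ k ≠ 1 := by
    intro k hk hkm h
    rw [← map_pow, MulEquiv.map_eq_one_iff, ← ofAdd_nsmul, ofAdd_eq_one, nsmul_one,
      ZMod.natCast_eq_zero_iff] at h
    exact absurd (Nat.le_of_dvd (by omega) h) (by omega)
  have h2 := hpow 2 (by simp) (by omega)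
  obtain ⟨hX, hd⟩ := isCayleySet_compl_ediam (e (.ofAdd 1)) h2
    (hpow 3 (by simp) (by omega)) (hpow 4 (by simp) (by omega))
  have : Finite C := Finite.of_equiv _ e.toEquiv
  have hcard : ({1, e (.ofAdd 1), (e (.ofAdd 1))⁻¹}ᶜ : Set C).ncard = m - 3 := by
    have h1 := hpow 1 (by simp) (by omega)
    rw [pow_one] at h1
    rw [Set.ncard_compl, ← Nat.card_congr e.toEquiv, Nat.card_congr Multiplicative.toAdd,
      Nat.card_zmod, Set.ncard_eq_three.2 ⟨1, _, _, h1.symm, ?_, ?_, rfl⟩]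
    · simpa [eq_comm] using h1
    · intro h
      exact h2 (by rw [sq]; nth_rw 1 [h]; simp)
  rw [minCyclicDegree_eq e]
  refine ⟨Nat.sInf_mem (s := {k : ℕ | ∃ X : Set C, IsCayleySet X ∧ X.ncard = k ∧
      (SimpleGraph.mulCayley X).ediam = 2}) ⟨_, _, hX, rfl, hd⟩, ?_⟩
  have := Nat.sInf_le (s := {k : ℕ | ∃ X : Set C, IsCayleySet X ∧ X.ncard = k ∧
      (SimpleGraph.mulCayley X).ediam = 2}) ⟨_, hX, hcard, hd⟩
  omega

end CyclicDegree

/-! ### Power maps of the field: the exponents ω, ω + 1 and ω + 2 are injective. -/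

section SuzukiField

theorem finite_of_card_eq {F : Type*} {n : ℕ} (hF : Nat.card F = 2 ^ (2 * n + 1)) : Finite F :=
  Nat.finite_of_card_ne_zero (by rw [hF]; positivity)

variable {F : Type*} [Field F] {n : ℕ}

theorem sq_injective_of_card (hF : Nat.card F = 2 ^ (2 * n + 1)) {x y : F} (h : x ^ 2 = y ^ 2) :
    x = y := by
  have h2 := two_eq_zero_of_card hF
  have : (x + y) ^ 2 = 0 := by grind
  have := pow_eq_zero_iff two_ne_zero |>.1 this
  grind

/-- Applying the map twice gives squaring, which is injective in characteristic 2. -/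
theorem pow_om_injective (hF : Nat.card F = 2 ^ (2 * n + 1)) :
    Function.Injective fun x : F => x ^ om n := by
  intro x y h
  refine sq_injective_of_card hF ?_
  rw [← pow_om_pow_om hF, ← pow_om_pow_om hF y]
  exact congrArg (· ^ om n) h

theorem pow_om_add_one_injective (hF : Nat.card F = 2 ^ (2 * n + 1)) :
    Function.Injective fun x : F => x ^ (om n + 1) := by
  intro x y h
  simp only [pow_succ] at h
  -- The ω-th power of the hypothesis reads x² x^ω = y² y^ω; comparison with x^ω x = y^ω y leaves x
  -- = y.
  have h' := congrArg (· ^ om n) h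
  simp only [mul_pow, pow_om_pow_om hF] at h'
  rcases eq_or_ne x 0 with rfl | hx
  · have : om n ≠ 0 := by simp [om]
    simp_all
  · have : x ^ om n ≠ 0 := pow_ne_zero _ hx
    grind

theorem pow_om_add_two_pow_om (hF : Nat.card F = 2 ^ (2 * n + 1)) (x : F) :
    (x ^ (om n + 2)) ^ om n = (x ^ (om n + 1)) ^ 2 := by
  rw [pow_add, mul_pow, pow_om_pow_om hF]
  ring

theorem pow_om_add_two_injective (hF : Nat.card F = 2 ^ (2 * n + 1)) :
    Function.Injective fun x : F => x ^ (om n + 2) := by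
  intro x y h
  refine pow_om_add_one_injective hF (sq_injective_of_card hF ?_)
  rw [← pow_om_add_two_pow_om hF, ← pow_om_add_two_pow_om hF]
  exact congrArg (· ^ om n) h

theorem exists_unit_pow_eq (hF : Nat.card F = 2 ^ (2 * n + 1)) {k : ℕ} (hk : k ≠ 0)
    (hinj : Function.Injective fun x : F => x ^ k) {y : F} (hy : y ≠ 0) :
    ∃ r : Fˣ, (r : F) ^ k = y := by
  have := finite_of_card_eq hF
  obtain ⟨x, rfl⟩ := Finite.surjective_of_injective hinj y
  exact ⟨Units.mk0 x (by rintro rfl; simp [hk] at hy), rfl⟩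

theorem pow_om_add_two_ne_one (hF : Nat.card F = 2 ^ (2 * n + 1)) {x : F} (hx : x ≠ 1) :
    x ^ (om n + 2) + 1 ≠ 0 := by
  have h2 := two_eq_zero_of_card hF
  intro h
  exact hx (pow_om_add_two_injective hF (by simp only [one_pow]; grind))

/-- The ω-th power of the hypothesis is the square of the conclusion. This makes S closed under
inverses and removes ρ^(ω+1) in the generic case. -/
theorem pow_om_add_one_eq (hF : Nat.card F = 2 ^ (2 * n + 1)) {r a : F}
    (h : r ^ (om n + 2) = a ^ (om n + 2) + 1) : r ^ (om n + 1) = a ^ (om n + 1) + 1 := by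
  have h2 := two_eq_zero_of_card hF
  refine sq_injective_of_card hF ?_
  rw [← pow_om_add_two_pow_om hF, h, add_pow_om hF, pow_om_add_two_pow_om hF, one_pow]
  grind

end SuzukiField

/-! ### Coordinates in G and the two point stabilisers. -/

section SuzukiElements

variable {F : Type*} [Field F] {n : ℕ}

theorem suzM_inj (hF : Nat.card F = 2 ^ (2 * n + 1)) {r s : Fˣ} {a b c d : F} :
    suzM hF r a b = suzM hF s c d ↔ r = s ∧ a = c ∧ b = d := by
  constructor
  · intro h
    have h' : suzMatrix n (r : F) a b = suzMatrix n (s : F) c d :=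
      congrArg (fun g : suzGroup hF => ((g : GL (Fin 4) F) : Matrix (Fin 4) (Fin 4) F)) h
    have h22 := congrFun (congrFun h' 2) 2
    have h02 := congrFun (congrFun h' 0) 2
    have h03 := congrFun (congrFun h' 0) 3
    simp [suzMatrix] at h22 h02 h03
    exact ⟨Units.ext h22, h02, h03⟩
  · rintro ⟨rfl, rfl, rfl⟩; rfl

theorem exists_eq_suzM (hF : Nat.card F = 2 ^ (2 * n + 1)) (g : suzGroup hF) :
    ∃ r a b, g = suzM hF r a b := by
  obtain ⟨g, r, a, b, rfl⟩ := g
  exact ⟨r, a, b, rfl⟩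

theorem suzM_one (hF : Nat.card F = 2 ^ (2 * n + 1)) : suzM hF 1 0 0 = 1 :=
  Subtype.ext suzGL_one

theorem suzM_inv (hF : Nat.card F = 2 ^ (2 * n + 1)) (r : Fˣ) (a b : F) :
    (suzM hF r a b)⁻¹ =
      suzM hF r⁻¹ (a / r) ((b + a ^ (om n + 1)) / (r : F) ^ (om n + 1)) := by
  have h2 := two_eq_zero_of_card hF
  have hr : (r : F) ≠ 0 := r.ne_zero
  rw [inv_eq_iff_mul_eq_one, suzM_mul, ← suzM_one, suzM_inj]
  refine ⟨by simp, ?_, ?_⟩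
  · push_cast; field_simp; grind
  · push_cast; simp only [div_pow, inv_pow, pow_succ]; field_simp; grind

theorem card_suzGroup (hF : Nat.card F = 2 ^ (2 * n + 1)) :
    Nat.card (suzGroup hF) = Nat.card F ^ 2 * (Nat.card F - 1) := by
  have := finite_of_card_eq hF
  have hbij : Function.Bijective (fun p : Fˣ × F × F => suzM hF p.1 p.2.1 p.2.2) := by
    constructor
    · rintro ⟨r, a, b⟩ ⟨s, c, d⟩ h
      simpa using (suzM_inj hF).1 h
    · intro g
      obtain ⟨r, a, b, rfl⟩ := exists_eq_suzM hF g
      exact ⟨(r, a, b), rfl⟩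
  rw [← Nat.card_congr (Equiv.ofBijective _ hbij), Nat.card_prod, Nat.card_prod, Nat.card_units]
  ring

theorem theta1_apply (hF : Nat.card F = 2 ^ (2 * n + 1)) (r : Fˣ) :
    theta1 hF r = suzM hF r ((r : F) + 1) ((r : F) + 1) := rfl

theorem theta2_apply (hF : Nat.card F = 2 ^ (2 * n + 1)) (r : Fˣ) :
    theta2 hF r = suzM hF r 0 (1 + (r : F) ^ (om n + 1)) := rfl

theorem theta1_injective (hF : Nat.card F = 2 ^ (2 * n + 1)) : Function.Injective (theta1 hF) :=
  fun _ _ h => ((suzM_inj hF).1 h).1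

theorem theta2_injective (hF : Nat.card F = 2 ^ (2 * n + 1)) : Function.Injective (theta2 hF) :=
  fun _ _ h => ((suzM_inj hF).1 h).1

theorem actRight_mk (v : Fin 4 → F) (hv : v ≠ 0) (A : GL (Fin 4) F) :
    actRight (Projectivization.mk F v hv) A =
      Projectivization.mk F (Matrix.vecMul v (A : Matrix (Fin 4) (Fin 4) F))
        (by simpa using (Matrix.vecMul_injective_of_isUnit A.isUnit).ne hv) := rfl

theorem ptOne_inj {x y z x' y' z' : F} :
    ptOne x y z = ptOne x' y' z' ↔ x = x' ∧ y = y' ∧ z = z' := by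
  constructor
  · intro h
    rw [ptOne, ptOne, Projectivization.mk_eq_mk_iff'] at h
    obtain ⟨t, ht⟩ := h
    have h0 := congrFun ht 0
    have h1 := congrFun ht 1
    have h2 := congrFun ht 2
    have h3 := congrFun ht 3
    simp at h0 h1 h2 h3
    subst h0
    simp_all
  · rintro ⟨rfl, rfl, rfl⟩; rfl

theorem actRight_ptOne (hF : Nat.card F = 2 ^ (2 * n + 1)) (x y z : F) (r : Fˣ) (a b : F) :
    actRight (ptOne x y z) (suzM hF r a b : GL (Fin 4) F) =
      ptOne (suzF n a b + x * (r : F) ^ (om n + 2) + y * ((a ^ (om n + 1) + b) * r) +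
          z * (a * (r : F) ^ (om n + 1)))
        (a + y * r) (b + y * (a ^ om n * r) + z * (r : F) ^ (om n + 1)) := by
  rw [ptOne, actRight_mk, ptOne]
  congr 1
  change Matrix.vecMul _ (suzMatrix n (r : F) a b) = _
  ext i
  fin_cases i <;> simp [suzMatrix, Matrix.vecMul, dotProduct, Fin.sum_univ_four]

theorem range_theta1 (hF : Nat.card F = 2 ^ (2 * n + 1)) :
    Set.range (theta1 hF) = suzStab hF (ptOne 1 1 1) := by
  have h2 := two_eq_zero_of_card hF
  ext g
  obtain ⟨r, a, b, rfl⟩ := exists_eq_suzM hF g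
  rw [suzStab, Set.mem_ofPred_eq, actRight_ptOne, ptOne_inj]
  constructor
  · rintro ⟨s, hs⟩
    obtain ⟨rfl, rfl, rfl⟩ := (suzM_inj hF).1 hs
    have hw := pow_om_pow_om hF (s : F)
    simp only [suzF, pow_add _ (om n), add_pow_om hF, one_pow, pow_one]
    refine ⟨?_, ?_, ?_⟩ <;> grind
  · rintro ⟨-, ha, hb⟩
    obtain rfl : a = r + 1 := by grind
    refine ⟨r, (suzM_inj hF).2 ⟨rfl, rfl, ?_⟩⟩
    simp only [pow_add _ (om n), add_pow_om hF, one_pow, pow_one] at hb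
    grind

theorem range_theta2 (hF : Nat.card F = 2 ^ (2 * n + 1)) :
    Set.range (theta2 hF) = suzStab hF (ptTwo 1 0) := by
  have h2 := two_eq_zero_of_card hF
  ext g
  obtain ⟨r, a, b, rfl⟩ := exists_eq_suzM hF g
  have hr : (r : F) ≠ 0 := r.ne_zero
  have hv : Matrix.vecMul ![0, 1, 1, 0] (suzMatrix n (r : F) a b) =
      ![0, (r : F) ^ (om n + 2) + (a ^ (om n + 1) + b) * r, r, a ^ om n * r] := by
    ext i
    fin_cases i <;> simp [suzMatrix, Matrix.vecMul, dotProduct, Fin.sum_univ_four]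
  have hom : om n ≠ 0 := by simp [om]
  have key : suzM hF r a b ∈ suzStab hF (ptTwo 1 0) ↔ a = 0 ∧ b = 1 + (r : F) ^ (om n + 1) := by
    rw [suzStab, Set.mem_ofPred_eq, ptTwo, actRight_mk, Projectivization.mk_eq_mk_iff']
    change (∃ t : F, t • ![0, 1, 1, 0] = Matrix.vecMul _ (suzMatrix n (r : F) a b)) ↔ _
    rw [hv]
    constructor
    · rintro ⟨t, ht⟩
      have h1 := congrFun ht 1
      have h2 := congrFun ht 2
      have h3 := congrFun ht 3
      simp [hom] at h1 h2 h3
      subst h2 h3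
      refine ⟨rfl, mul_right_cancel₀ hr ?_⟩
      simp only [pow_add _ (om n), zero_pow hom] at h1 ⊢
      grind
    · rintro ⟨rfl, rfl⟩
      refine ⟨r, ?_⟩
      ext i
      fin_cases i <;> simp [hom]
      simp only [pow_add _ (om n)]
      grind
  rw [key]
  constructor
  · rintro ⟨s, hs⟩
    obtain ⟨rfl, rfl, rfl⟩ := (suzM_inj hF).1 hs
    exact ⟨rfl, rfl⟩
  · rintro ⟨rfl, rfl⟩
    exact ⟨r, rfl⟩

end SuzukiElements

/-! ### The neighbours of [1,1,0,0] and the equations of S. -/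

section BaseNeighbours

variable {F : Type*} [Field F] {n : ℕ}

/-- The spanning vectors are the rows of an alternating matrix of Plücker coordinates; the equations
come from the dual coordinates and hold by the Plücker relation `hc`. -/
theorem mem_polarSpan_eqs (hF : Nat.card F = 2 ^ (2 * n + 1)) {x y : Fin 4 → F}
    (hy : y ∈ polarSpan n x) :
    (x 0 * x 1 + x 2 * x 3) ^ (2 ^ n) * y 1 + x 1 ^ om n * y 2 + x 3 ^ om n * y 3 = 0 ∧
    (x 0 * x 1 + x 2 * x 3) ^ (2 ^ n) * y 0 + x 2 ^ om n * y 2 + x 0 ^ om n * y 3 = 0 ∧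
    x 1 ^ om n * y 0 + x 2 ^ om n * y 1 + (x 0 * x 1 + x 2 * x 3) ^ (2 ^ n) * y 3 = 0 ∧
    x 3 ^ om n * y 0 + x 0 ^ om n * y 1 + (x 0 * x 1 + x 2 * x 3) ^ (2 ^ n) * y 2 = 0 := by
  have h2 := two_eq_zero_of_card hF
  have hc : ((x 0 * x 1 + x 2 * x 3) ^ (2 ^ n)) ^ 2 =
      x 0 ^ om n * x 1 ^ om n + x 2 ^ om n * x 3 ^ om n := by
    rw [← mul_pow, ← mul_pow, ← add_pow_om hF, ← pow_mul]
    rfl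
  rw [polarSpan] at hy
  generalize (x 0 * x 1 + x 2 * x 3) ^ (2 ^ n) = c at hc hy ⊢
  induction hy using Submodule.span_induction with
  | mem y hy =>
    rcases hy with rfl | rfl | rfl | rfl <;> refine ⟨?_, ?_, ?_, ?_⟩ <;> simp <;> grind
  | zero => simp
  | add y z _ _ hy hz => simp only [Pi.add_apply]; refine ⟨?_, ?_, ?_, ?_⟩ <;> grind
  | smul t y _ hy => simp only [Pi.smul_apply, smul_eq_mul]; refine ⟨?_, ?_, ?_, ?_⟩ <;> grind

theorem ptOne_mem_orbit5 {x y z : F} : ptOne x y z ∈ orbit5 F n ↔ x ≠ suzF n y z := by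
  have h0 : ∀ (v : Fin 4 → F) (hv : v ≠ 0), v 0 = 0 → ptOne x y z ≠ Projectivization.mk F v hv := by
    intro v hv h0 h
    rw [ptOne, Projectivization.mk_eq_mk_iff'] at h
    obtain ⟨t, ht⟩ := h
    simpa [h0] using congrFun ht 0
  rw [orbit5, Set.mem_compl_iff, not_iff_not]
  constructor
  · rintro (((⟨a, b, h⟩ | ⟨a, b, h⟩) | ⟨a, h⟩) | h)
    · obtain ⟨rfl, rfl, rfl⟩ := ptOne_inj.1 h; rfl
    · exact absurd h (h0 _ _ rfl)
    · exact absurd h (h0 _ _ rfl)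
    · exact absurd h (h0 _ _ rfl)
  · rintro rfl
    exact Or.inl (Or.inl (Or.inl ⟨_, _, rfl⟩))

theorem mk_submodule_le_polarLine {v w : Fin 4 → F} (hv : v ≠ 0) (hw : w ≠ 0) :
    (Projectivization.mk F v hv).submodule ≤ polarLine n (Projectivization.mk F w hw) ↔
      v ∈ polarSpan n w := by
  rw [Projectivization.submodule_mk, Submodule.span_singleton_le_iff_mem]
  rfl

theorem polarityGraph_adj_base (hF : Nat.card F = 2 ^ (2 * n + 1)) (x y z : F) :
    (polarityGraph F n).Adj (ptOne 1 0 0) (ptOne x y z) ↔ z = 1 ∧ x = y := by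
  have h2 := two_eq_zero_of_card hF
  have hom : om n ≠ 0 := by simp [om]
  rw [polarityGraph, SimpleGraph.fromRel_adj, Ne, ptOne_inj]
  rw [ptOne, ptOne, mk_submodule_le_polarLine, mk_submodule_le_polarLine]
  constructor
  · rintro ⟨-, h | h⟩
    · have h' := mem_polarSpan_eqs hF h
      simp at h'
      exact ⟨pow_om_injective hF (by simp only [one_pow]; grind),
        pow_om_injective hF (by simp only []; grind)⟩
    · have h' := mem_polarSpan_eqs hF h
      simp [hom] at h'
      grind
  · rintro ⟨rfl, rfl⟩
    refine ⟨by simp, Or.inr ?_⟩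
    have : (![1, x, x, 1] : Fin 4 → F) = ![1, 0, 0, 1] + x • ![0, 1, 1, 0] := by
      ext i; fin_cases i <;> simp
    rw [this]
    refine add_mem (Submodule.subset_span ?_) (Submodule.smul_mem _ _ (Submodule.subset_span ?_))
    · simp [hom]
    · simp [hom]

theorem suzM_mem_genS (hF : Nat.card F = 2 ^ (2 * n + 1)) {r : Fˣ} {a b : F} :
    suzM hF r a b ∈ genS hF ↔ b = 1 ∧ (r : F) ^ (om n + 2) = a ^ (om n + 2) + 1 := by
  have h2 := two_eq_zero_of_card hF
  rw [genS, Set.mem_ofPred_eq, actRight_ptOne, ptOne_mem_orbit5, polarityGraph_adj_base hF]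
  constructor
  · rintro ⟨-, hb, h⟩
    simp at hb
    subst hb
    simp [suzF] at h
    exact ⟨rfl, by grind⟩
  · rintro ⟨rfl, h⟩
    simp [suzF, h]
    exact ⟨h ▸ pow_ne_zero _ r.ne_zero, by grind⟩

end BaseNeighbours

/-! ### The connection set S^*: inverses and cardinality. -/

section Generators

variable {F : Type*} [Field F] {n : ℕ}

theorem inv_mem_genS (hF : Nat.card F = 2 ^ (2 * n + 1)) {g : suzGroup hF} (hg : g ∈ genS hF) :
    g⁻¹ ∈ genS hF := by
  have h2 := two_eq_zero_of_card hF
  obtain ⟨r, a, b, rfl⟩ := exists_eq_suzM hF g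
  obtain ⟨rfl, h⟩ := (suzM_mem_genS hF).1 hg
  have h' := pow_om_add_one_eq hF h
  have hr : (r : F) ^ (om n + 2) ≠ 0 := pow_ne_zero _ r.ne_zero
  have hr' : (r : F) ^ (om n + 1) ≠ 0 := pow_ne_zero _ r.ne_zero
  rw [suzM_inv, suzM_mem_genS]
  refine ⟨?_, ?_⟩
  · rw [div_eq_one_iff_eq hr']; grind
  · push_cast
    rw [inv_pow, div_pow, inv_eq_one_div, div_add_one hr, h]
    congr 1
    grind

/-- The entry a determines r, since the power ω + 2 is bijective; only a = 1 is excluded, as it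
would give r = 0. -/
theorem ncard_genS (hF : Nat.card F = 2 ^ (2 * n + 1)) :
    (genS hF).ncard = Nat.card F - 1 := by
  have h2 := two_eq_zero_of_card hF
  have := finite_of_card_eq hF
  have hex : ∀ a ∈ ({1}ᶜ : Set F), ∃ r : Fˣ, (r : F) ^ (om n + 2) = a ^ (om n + 2) + 1 :=
    fun a ha => exists_unit_pow_eq hF (by simp) (pow_om_add_two_injective hF)
      (pow_om_add_two_ne_one hF ha)
  choose ρ hρ using hex
  have h := Set.ncard_congr (s := ({1}ᶜ : Set F)) (t := genS hF)
    (fun a ha => suzM hF (ρ a ha) a 1)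
    (fun a ha => (suzM_mem_genS hF).2 ⟨rfl, hρ a ha⟩)
    (fun a b ha hb h => ((suzM_inj hF).1 h).2.1)
    (fun g hg => by
      obtain ⟨r, a, b, rfl⟩ := exists_eq_suzM hF g
      obtain ⟨rfl, h⟩ := (suzM_mem_genS hF).1 hg
      have ha : a ∈ ({1}ᶜ : Set F) := by
        rintro rfl
        simp only [one_pow] at h
        have : (r : F) ^ (om n + 2) ≠ 0 := pow_ne_zero _ r.ne_zero
        grind
      exact ⟨a, ha, (suzM_inj hF).2
        ⟨Units.ext (pow_om_add_two_injective hF (by simp only [hρ, h])), rfl, rfl⟩⟩)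
  rw [← h, Set.ncard_compl, Set.ncard_singleton]

theorem suzM_one_one_one_inv (hF : Nat.card F = 2 ^ (2 * n + 1)) :
    (suzM hF 1 1 1)⁻¹ = suzM hF 1 1 0 := by
  have h2 := two_eq_zero_of_card hF
  rw [suzM_inv, suzM_inj]
  simp
  grind

theorem genS3_eq (hF : Nat.card F = 2 ^ (2 * n + 1)) :
    genS3 hF = {suzM hF 1 1 1, suzM hF 1 1 0} := by
  have h := suzM_one_one_one_inv hF
  have h' : (suzM hF 1 1 0)⁻¹ = suzM hF 1 1 1 := by rw [← h, inv_inv]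
  rw [genS3, h, h']
  ext g
  simp only [Set.mem_insert_iff, Set.mem_singleton_iff]
  tauto

theorem isCayleySet_genSStar (hF : Nat.card F = 2 ^ (2 * n + 1)) {X : Set Fˣ}
    (hX : IsCayleySet X) : IsCayleySet (genSStar hF X) := by
  have h2 := two_eq_zero_of_card hF
  constructor
  · rintro (((h | ⟨r, hr, h⟩) | ⟨r, hr, h⟩) | h)
    · rw [← suzM_one, suzM_mem_genS] at h
      exact zero_ne_one h.1
    · rw [theta1_injective hF (h.trans (map_one _).symm)] at hr
      exact hX.1 hr
    · rw [theta2_injective hF (h.trans (map_one _).symm)] at hr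
      exact hX.1 hr
    · rw [genS3_eq, ← suzM_one] at h
      rcases h with h | h <;> simp [suzM_inj] at h
  · rintro g (((h | ⟨r, hr, rfl⟩) | ⟨r, hr, rfl⟩) | h)
    · exact Or.inl (Or.inl (Or.inl (inv_mem_genS hF h)))
    · exact Or.inl (Or.inl (Or.inr ⟨r⁻¹, hX.2 r hr, map_inv _ _⟩))
    · exact Or.inl (Or.inr ⟨r⁻¹, hX.2 r hr, map_inv _ _⟩)
    · refine Or.inr ?_
      rcases h with rfl | rfl | rfl | rfl <;> simp [genS3]

theorem ncard_genSStar (hF : Nat.card F = 2 ^ (2 * n + 1)) {X : Set Fˣ} (hX : IsCayleySet X) :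
    (genSStar hF X).ncard = Nat.card F + 2 * X.ncard + 1 := by
  have h2 := two_eq_zero_of_card hF
  have := finite_of_card_eq hF
  have hfin : Finite (suzGroup hF) :=
    Finite.of_surjective (fun p : Fˣ × F × F => suzM hF p.1 p.2.1 p.2.2) fun g => by
      obtain ⟨r, a, b, rfl⟩ := exists_eq_suzM hF g
      exact ⟨(r, a, b), rfl⟩
  have d1 : Disjoint (genS hF) (theta1 hF '' X) := by
    rw [Set.disjoint_left]
    rintro _ h ⟨r, hr, rfl⟩
    rw [theta1_apply, suzM_mem_genS] at h
    exact r.ne_zero (by simpa using h.1)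
  have d2 : Disjoint (genS hF ∪ theta1 hF '' X) (theta2 hF '' X) := by
    rw [Set.disjoint_left]
    rintro _ (h | ⟨s, hs, h⟩) ⟨r, hr, rfl⟩
    · rw [theta2_apply, suzM_mem_genS] at h
      have : (r : F) ^ (om n + 1) ≠ 0 := pow_ne_zero _ r.ne_zero
      exact this (by simpa using h.1)
    · rw [theta1_apply, theta2_apply, suzM_inj] at h
      have : s = 1 := Units.ext (by rw [Units.val_one]; grind)
      exact hX.1 (this ▸ hs)
  have d3 : Disjoint (genS hF ∪ theta1 hF '' X ∪ theta2 hF '' X) (genS3 hF) := by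
    rw [genS3_eq, Set.disjoint_left]
    intro g hg hg3
    have hone : ∀ r ∈ X, ∀ a b c d, suzM hF r a b = suzM hF 1 c d → False :=
      fun r hr a b c d h => hX.1 (((suzM_inj hF).1 h).1 ▸ hr)
    rcases hg with (h | ⟨r, hr, h⟩) | ⟨r, hr, h⟩
    · rcases hg3 with rfl | rfl
      all_goals
        rw [suzM_mem_genS] at h
        simp at h
    · rcases hg3 with h' | h' <;> exact hone r hr _ _ _ _ (h.trans h')
    · rcases hg3 with h' | h' <;> exact hone r hr _ _ _ _ (h.trans h')
  have h3 : (genS3 hF).ncard = 2 := by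
    rw [genS3_eq, Set.ncard_pair]
    simp [suzM_inj]
  have hq : 0 < Nat.card F := by rw [hF]; positivity
  rw [genSStar, Set.ncard_union_eq d3, Set.ncard_union_eq d2, Set.ncard_union_eq d1, ncard_genS,
    Set.ncard_image_of_injective _ (theta1_injective hF),
    Set.ncard_image_of_injective _ (theta2_injective hF), h3]
  omega

end Generators

/-! ### Factorisations of M(r;a,b), generic and exceptional. -/

section Covering

variable {F : Type*} [Field F] {n : ℕ}

theorem exists_suzM_mul_theta2_mem (hF : Nat.card F = 2 ^ (2 * n + 1)) (r : Fˣ) (a : F) :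
    ∃ ρ : Fˣ, suzM hF r a 1 * theta2 hF ρ ∈ insert 1 (genS hF ∪ genS3 hF) := by
  have h2 := two_eq_zero_of_card hF
  have hom : om n ≠ 0 := by simp [om]
  have hmul : ∀ ρ : Fˣ, suzM hF r a 1 * theta2 hF ρ = suzM hF (r * ρ) (a * ρ) 1 := by
    intro ρ
    rw [theta2_apply, suzM_mul, suzM_inj, zero_pow hom]
    refine ⟨rfl, by simp, by grind⟩
  -- Membership in S means ρ^(ω+2) (r^(ω+2) + a^(ω+2)) = 1, which is solvable unless a = r; in that
  -- case ρ = r⁻¹ gives M(1;1,1).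
  by_cases har : a = r
  · refine ⟨r⁻¹, Or.inr (Or.inr ?_)⟩
    rw [hmul, genS3_eq, har]
    simp
  · have hne : (r : F) ^ (om n + 2) + a ^ (om n + 2) ≠ 0 := by
      intro h
      exact har (pow_om_add_two_injective hF (by simp only; grind))
    obtain ⟨ρ, hρ⟩ := exists_unit_pow_eq hF (by simp) (pow_om_add_two_injective hF)
      (inv_ne_zero hne)
    refine ⟨ρ, Or.inr (Or.inl ?_)⟩
    rw [hmul, suzM_mem_genS]
    refine ⟨rfl, ?_⟩
    push_cast
    rw [mul_pow, mul_pow, hρ]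
    field_simp
    grind

theorem exists_suzM_mul_theta1_mem (hF : Nat.card F = 2 ^ (2 * n + 1)) (r : Fˣ) (a b : F)
    (hb : b ≠ 1) (h : (b + a ^ (om n + 1) + (r : F) ^ (om n + 1)) ^ om n = (1 + a) * (1 + b)) :
    ∃ ρ : Fˣ, suzM hF r a b * theta1 hF ρ ∈ insert 1 (genS hF ∪ genS3 hF) := by
  have h2 := two_eq_zero_of_card hF
  have hmul : ∀ ρ : Fˣ, suzM hF r a b * theta1 hF ρ = suzM hF (r * ρ) (a * ρ + (ρ + 1))
      ((a + b) * (ρ : F) ^ (om n + 1) + (a + 1) * ρ + 1) := by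
    intro ρ
    rw [theta1_apply, suzM_mul, suzM_inj, add_pow_om hF, one_pow]
    refine ⟨rfl, rfl, ?_⟩
    rw [pow_succ]
    ring
  have hexp : b ^ om n + a ^ (om n + 2) + (r : F) ^ (om n + 2) = (1 + a) * (1 + b) := by
    rw [← h, add_pow_om hF, add_pow_om hF, ← pow_mul, ← pow_mul, add_mul, one_mul, pow_add _ (_ * _),
      pow_add _ (_ * _), pow_mul, pow_mul, pow_om_pow_om hF, pow_om_pow_om hF]
    ring
  have hab1 : 1 + b ≠ 0 := fun h => hb (by grind)
  -- The last entry of the product is 1 exactly when (a+b) ρ^ω = a + 1. This determines ρ unless a =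
  -- b, where the product can be made 1, or a = 1, where it can be made M(1;1,0).
  by_cases hab : a = b
  · subst hab
    refine ⟨Units.mk0 _ (inv_ne_zero hab1), Or.inl ?_⟩
    have hr : (r : F) = 1 + a := by
      refine pow_om_add_two_injective hF ?_
      simp only [pow_add _ (om n), add_pow_om hF, one_pow] at hexp ⊢
      grind
    rw [hmul, ← suzM_one, suzM_inj]
    refine ⟨?_, ?_, ?_⟩
    · ext; simp [hr, hab1]
    · simp; field_simp; grind
    · simp; field_simp; grind
  by_cases ha1 : a = 1
  · subst ha1
    obtain ⟨ρ, hρ⟩ := exists_unit_pow_eq hF (by simp) (pow_om_add_one_injective hF)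
      (inv_ne_zero hab1)
    refine ⟨ρ, Or.inr (Or.inr ?_)⟩
    have hr : r * ρ = 1 := by
      ext
      refine pow_om_add_two_injective hF ?_
      simp only [Units.val_mul, Units.val_one, mul_pow, one_pow] at hexp ⊢
      have h1 : (r : F) ^ (om n + 2) = (1 + b) ^ om n := by
        rw [add_pow_om hF, one_pow]; grind
      have h3 : (ρ : F) ^ (om n + 2) = ((1 + b) ^ om n)⁻¹ := by
        rw [← inv_pow, ← hρ]
        rw [pow_succ _ (om n), mul_pow, pow_om_pow_om hF]; ring
      rw [h1, h3, mul_inv_cancel₀ (pow_ne_zero _ hab1)]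
    rw [hmul, genS3_eq, hr, hρ]
    refine Or.inr ((suzM_inj hF).2 ⟨rfl, ?_, ?_⟩)
    · grind
    · rw [mul_inv_cancel₀ hab1]; grind
  · have hab' : a + b ≠ 0 := by grind
    have ha1' : a + 1 ≠ 0 := by grind
    obtain ⟨ρ, hρ⟩ := exists_unit_pow_eq hF (by simp [om]) (pow_om_injective hF)
      (div_ne_zero ha1' hab')
    refine ⟨ρ, Or.inr (Or.inl ?_)⟩
    have hρ2 : (ρ : F) ^ 2 * (a ^ om n + b ^ om n) = a ^ om n + 1 := by
      have := congrArg (· ^ om n) hρ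
      simp only [pow_om_pow_om hF, div_pow, add_pow_om hF, one_pow] at this
      rw [this, div_mul_cancel₀]
      rw [← add_pow_om hF]
      exact pow_ne_zero _ hab'
    rw [eq_div_iff hab'] at hρ
    rw [hmul, suzM_mem_genS]
    simp only [pow_add _ (om n), add_pow_om hF, one_pow, Units.val_mul, mul_pow, pow_one] at hexp ⊢
    constructor
    · grind
    · have k1 : (a ^ om n + 1) * (ρ : F) ^ om n =
          (ρ : F) ^ om n * (ρ : F) ^ 2 * (a ^ om n + b ^ om n) := by rw [← hρ2]; ring
      have k2 : (a + 1) ^ 2 * (ρ : F) ^ 2 =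
          (a + 1) * ((ρ : F) ^ om n * (ρ : F) ^ 2 * (a + b)) := by
        linear_combination -(a + 1) * (ρ : F) ^ 2 * hρ
      have k3 := congrArg ((ρ : F) ^ om n * (ρ : F) ^ 2 * ·) hexp
      clear hρ hρ2 hexp
      grind

/-- Let A be the a-entry of both sides and t that of y. Equality of the b-entries becomes A (t+a)^ω
= D, and x ∈ S becomes A^ω (t+a)² + A² (t+a)^ω = D^ω + E^ω. The first equation gives A^ω (t+a)² =
D^ω, hence AD = E^ω, so A = E^ω/D and t = a + D^ω/E. The last two hypotheses say that y and z avoid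
the a-entry 1, which is impossible in S. -/
theorem exists_mul_mul_mem_genS (hF : Nat.card F = 2 ^ (2 * n + 1)) (r : Fˣ) (a b : F)
    (hb : b ≠ 1) (h0 : b + a ^ (om n + 1) + (r : F) ^ (om n + 1) ≠ 0)
    (h1 : (b + a ^ (om n + 1) + (r : F) ^ (om n + 1)) ^ om n ≠ (1 + a) * (1 + b))
    (h1' : (1 + b) ^ om n ≠ (r + a) * (b + a ^ (om n + 1) + (r : F) ^ (om n + 1))) :
    ∃ x ∈ genS hF, ∃ y ∈ genS hF, ∃ z ∈ genS hF, z * suzM hF r a b = x * y := by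
  have h2 := two_eq_zero_of_card hF
  have hr := r.ne_zero
  obtain ⟨D, hD⟩ : ∃ D, b + a ^ (om n + 1) + (r : F) ^ (om n + 1) = D := ⟨_, rfl⟩
  obtain ⟨E, hE⟩ : ∃ E, 1 + b = E := ⟨_, rfl⟩
  rw [hD] at h0 h1 h1'
  rw [hE] at h1 h1'
  have hE0 : E ≠ 0 := by grind
  have hDw : D ^ om n = b ^ om n + a ^ om n * a ^ 2 + (r : F) ^ om n * (r : F) ^ 2 := by
    rw [← hD, add_pow_om hF, add_pow_om hF, pow_succ, pow_succ, mul_pow, mul_pow, pow_om_pow_om hF,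
      pow_om_pow_om hF]
    ring
  have hEw : E ^ om n = 1 + b ^ om n := by rw [← hE, add_pow_om hF, one_pow]
  have hDw0 : D ^ om n ≠ 0 := pow_ne_zero _ h0
  have hEw0 : E ^ om n ≠ 0 := pow_ne_zero _ hE0
  obtain ⟨t, ht⟩ : ∃ t, t = a + D ^ om n / E := ⟨_, rfl⟩
  obtain ⟨A, hA⟩ : ∃ A, A = E ^ om n / D := ⟨_, rfl⟩
  have htw : t ^ om n = a ^ om n + D ^ 2 / E ^ om n := by
    rw [ht, add_pow_om hF, div_pow, pow_om_pow_om hF]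
  have hAw : A ^ om n = E ^ 2 / D ^ om n := by rw [hA, div_pow, pow_om_pow_om hF]
  have ht1 : t ≠ 1 := by
    rintro rfl
    apply h1
    field_simp at ht
    grind
  have hτ1 : (A + a) / r ≠ 1 := by
    rw [Ne, div_eq_one_iff_eq hr]
    intro h
    apply h1'
    rw [← h, hA]
    field_simp
    grind
  obtain ⟨ρ, hρ⟩ := exists_unit_pow_eq hF (by simp) (pow_om_add_two_injective hF)
    (pow_om_add_two_ne_one hF ht1)
  obtain ⟨ρ', hρ'⟩ := exists_unit_pow_eq hF (by simp) (pow_om_add_two_injective hF)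
    (pow_om_add_two_ne_one hF hτ1)
  have hρ1 := pow_om_add_one_eq hF hρ
  have hρ0 := ρ.ne_zero
  refine ⟨suzM hF (ρ' * r * ρ⁻¹) ((A + t) / ρ) 1, (suzM_mem_genS hF).2 ⟨rfl, ?_⟩,
    suzM hF ρ t 1, (suzM_mem_genS hF).2 ⟨rfl, hρ⟩,
    suzM hF ρ' ((A + a) / r) 1, (suzM_mem_genS hF).2 ⟨rfl, hρ'⟩, ?_⟩
  · push_cast
    have hρp : (ρ : F) ^ (om n + 2) ≠ 0 := pow_ne_zero _ hρ0
    have hrp : (r : F) ^ (om n + 2) ≠ 0 := pow_ne_zero _ hr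
    rw [mul_pow, mul_pow, hρ', inv_pow, ← div_eq_mul_inv, div_pow _ (ρ : F), div_add_one hρp]
    congr 1
    rw [div_pow, div_add_one hrp, div_mul_cancel₀ _ hrp, hρ]
    have e1 : A ^ om n * (t + a) ^ 2 = D ^ om n := by
      have : t + a = D ^ om n / E := by grind
      rw [this, hAw]; field_simp
    have e2 : A ^ 2 * (t ^ om n + a ^ om n) = E ^ om n := by
      have : t ^ om n + a ^ om n = D ^ 2 / E ^ om n := by grind
      rw [this, hA]; field_simp
    clear hAw htw hA ht
    simp only [pow_add _ (om n), add_pow_om hF]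
    grind
  · rw [suzM_mul, suzM_mul, suzM_inj]
    refine ⟨by simp, by field_simp; grind, ?_⟩
    have e1 : A * (t ^ om n + a ^ om n) = D := by
      have : t ^ om n + a ^ om n = D ^ 2 / E ^ om n := by grind
      rw [this, hA]; field_simp
    have e2 : (A + a) / r * a ^ om n * r = (A + a) * a ^ om n := by field_simp
    have e3 : (A + t) / ρ * t ^ om n * ρ = (A + t) * t ^ om n := by field_simp
    rw [e2, e3, hρ1]
    clear hAw htw hA ht
    simp only [pow_succ _ (om n)] at hD ⊢
    grind

end Covering

/-! ### Assembling the diameter bound. -/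

section Diameter

variable {F : Type*} [Field F] {n : ℕ}

theorem exists_eq_mul_mul_of_mem (hF : Nat.card F = 2 ^ (2 * n + 1)) {X : Set Fˣ}
    (hX : IsCayleySet X) (hd : (SimpleGraph.mulCayley X).ediam ≤ 2) {θ : Fˣ →* suzGroup hF}
    (hθ : θ '' X ⊆ genSStar hF X) {g : suzGroup hF} {ρ : Fˣ}
    (h : g * θ ρ ∈ insert 1 (genS hF ∪ genS3 hF)) :
    ∃ x ∈ insert 1 (genSStar hF X), ∃ y ∈ insert 1 (genSStar hF X),
      ∃ z ∈ insert 1 (genSStar hF X), g = x * y * z := by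
  have hθ' : ∀ x ∈ insert 1 X, θ x ∈ insert 1 (genSStar hF X) := by
    rintro x (rfl | hx)
    · exact Or.inl (map_one θ)
    · exact Or.inr (hθ ⟨x, hx, rfl⟩)
  obtain ⟨x, hx, y, hy, hxy⟩ := hX.ediam_le_two_iff.1 hd ρ⁻¹
  refine ⟨g * θ ρ, ?_, θ x, hθ' x hx, θ y, hθ' y hy, ?_⟩
  · rcases h with h | h | h
    · exact Or.inl h
    · exact Or.inr (Or.inl (Or.inl (Or.inl h)))
    · exact Or.inr (Or.inr h)
  · rw [mul_assoc, mul_assoc, ← map_mul, ← map_mul, ← hxy]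
    simp

theorem exists_eq_mul_mul (hF : Nat.card F = 2 ^ (2 * n + 1)) {X : Set Fˣ}
    (hX : IsCayleySet X) (hd : (SimpleGraph.mulCayley X).ediam ≤ 2) (g : suzGroup hF) :
    ∃ x ∈ insert 1 (genSStar hF X), ∃ y ∈ insert 1 (genSStar hF X),
      ∃ z ∈ insert 1 (genSStar hF X), g = x * y * z := by
  have h2 := two_eq_zero_of_card hF
  have hS := isCayleySet_genSStar hF hX
  have hinv : ∀ x ∈ insert 1 (genSStar hF X), x⁻¹ ∈ insert 1 (genSStar hF X) := by
    rintro x (rfl | hx)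
    · exact Or.inl inv_one
    · exact Or.inr (hS.2 x hx)
  have hswap : ∀ g : suzGroup hF, (∃ x ∈ insert 1 (genSStar hF X),
      ∃ y ∈ insert 1 (genSStar hF X), ∃ z ∈ insert 1 (genSStar hF X), g⁻¹ = x * y * z) →
      ∃ x ∈ insert 1 (genSStar hF X), ∃ y ∈ insert 1 (genSStar hF X),
        ∃ z ∈ insert 1 (genSStar hF X), g = x * y * z := by
    rintro g ⟨x, hx, y, hy, z, hz, h⟩
    exact ⟨_, hinv z hz, _, hinv y hy, _, hinv x hx, by rw [← inv_inv g, h]; group⟩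
  have hθ1 : theta1 hF '' X ⊆ genSStar hF X := fun x hx => Or.inl (Or.inl (Or.inr hx))
  have hθ2 : theta2 hF '' X ⊆ genSStar hF X := fun x hx => Or.inl (Or.inr hx)
  have hb1 : ∀ (r : Fˣ) (a b : F), b = 1 → _ := fun r a b hb =>
    have ⟨ρ, h⟩ := exists_suzM_mul_theta2_mem hF r a
    exists_eq_mul_mul_of_mem hF hX hd hθ2 (g := suzM hF r a b) (ρ := ρ) (hb ▸ h)
  have ht1 : ∀ (r : Fˣ) (a b : F), b ≠ 1 →
      (b + a ^ (om n + 1) + (r : F) ^ (om n + 1)) ^ om n = (1 + a) * (1 + b) → _ :=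
    fun r a b hb h =>
      have ⟨ρ, h⟩ := exists_suzM_mul_theta1_mem hF r a b hb h
      exists_eq_mul_mul_of_mem hF hX hd hθ1 h
  obtain ⟨r, a, b, rfl⟩ := exists_eq_suzM hF g
  by_cases hb : b = 1
  · exact hb1 r a b hb
  have hr : (r : F) ≠ 0 := r.ne_zero
  have hr1 : (r : F) ^ (om n + 1) ≠ 0 := pow_ne_zero _ hr
  -- Inversion sends E to D/r^(ω+1) and D to E/r^(ω+1), so it turns the two bad conditions on w into
  -- those on p.
  by_cases h0 : b + a ^ (om n + 1) + (r : F) ^ (om n + 1) = 0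
  · apply hswap
    rw [suzM_inv]
    exact hb1 _ _ _ (by rw [div_eq_one_iff_eq hr1]; grind)
  by_cases h1 : (b + a ^ (om n + 1) + (r : F) ^ (om n + 1)) ^ om n = (1 + a) * (1 + b)
  · exact ht1 r a b hb h1
  by_cases h1' : (1 + b) ^ om n = (r + a) * (b + a ^ (om n + 1) + (r : F) ^ (om n + 1))
  · apply hswap
    rw [suzM_inv]
    refine ht1 _ _ _ (by rw [Ne, div_eq_one_iff_eq hr1]; grind) ?_
    have e1 : (b + a ^ (om n + 1)) / (r : F) ^ (om n + 1) + (a / r) ^ (om n + 1) +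
        ((r⁻¹ : Fˣ) : F) ^ (om n + 1) = (1 + b) / (r : F) ^ (om n + 1) := by
      push_cast
      rw [div_pow, inv_pow]
      field_simp
      grind
    have e2 : (r : F) ^ (om n + 1) ≠ 0 := hr1
    rw [e1, div_pow, h1', pow_succ (r : F), mul_pow, pow_om_pow_om hF]
    have e3 : (r : F) ^ om n ≠ 0 := pow_ne_zero _ hr
    field_simp
    ring
  · obtain ⟨x, hx, y, hy, z, hz, h⟩ := exists_mul_mul_mem_genS hF r a b hb h0 h1 h1'
    have hsub : genS hF ⊆ insert 1 (genSStar hF X) :=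
      fun x hx => Or.inr (Or.inl (Or.inl (Or.inl hx)))
    exact ⟨z⁻¹, hinv z (hsub hz), x, hsub hx, y, hsub hy, by rw [mul_assoc, ← h]; simp⟩

end Diameter

theorem theorem1 (n : ℕ) (hn : 1 ≤ n) {F : Type*} [Field F]
    (hF : Nat.card F = 2 ^ (2 * n + 1)) (q : ℕ) (hq : q = 2 ^ (2 * n + 1)) :
    Nat.card (suzGroup hF) = q ^ 2 * (q - 1) ∧
    (Function.Injective (theta1 hF) ∧ Set.range (theta1 hF) = suzStab hF (ptOne 1 1 1)) ∧
    (Function.Injective (theta2 hF) ∧ Set.range (theta2 hF) = suzStab hF (ptTwo 1 0)) ∧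
    (∃ X : Set Fˣ, IsOptimalX X) ∧
    ∀ X : Set Fˣ, IsOptimalX X →
      IsCayleySet (genSStar hF X) ∧
      (∀ g : suzGroup hF, ((SimpleGraph.mulCayley (genSStar hF X)).neighborSet g).ncard =
        q + 2 * minCyclicDegree (q - 1) + 1) ∧
      (SimpleGraph.mulCayley (genSStar hF X)).ediam = 3 := by
  have hqF : q = Nat.card F := hq.trans hF.symm
  have hfin := finite_of_card_eq hF
  have hq8 : 8 ≤ q := by
    rw [hq]
    exact Nat.pow_le_pow_right (n := 2) (by norm_num) (by omega : 3 ≤ 2 * n + 1)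
  have e : Multiplicative (ZMod (Nat.card F - 1)) ≃* Fˣ :=
    (Nat.card_units F) ▸ zmodCyclicMulEquiv (inferInstance : IsCyclic Fˣ)
  obtain ⟨hex, hc⟩ := exists_ncard_eq_minCyclicDegree e (by omega)
  have hcard : Nat.card (suzGroup hF) = q ^ 2 * (q - 1) := by rw [card_suzGroup, hqF]
  refine ⟨hcard, ⟨theta1_injective hF, range_theta1 hF⟩, ⟨theta2_injective hF, range_theta2 hF⟩,
    hex, fun X ⟨hX, hXc, hXd⟩ => ?_⟩
  have hS := isCayleySet_genSStar hF hX
  have hdeg : (genSStar hF X).ncard = q + 2 * minCyclicDegree (q - 1) + 1 := by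
    rw [ncard_genSStar hF hX, hXc, hqF]
  refine ⟨hS, fun g => by rw [hS.ncard_neighborSet, hdeg],
    le_antisymm (hS.ediam_le_three (exists_eq_mul_mul hF hX hXd.le)) ?_⟩
  by_contra! h
  have hG : Finite (suzGroup hF) := Nat.finite_of_card_ne_zero (by
    rw [hcard]; exact mul_ne_zero (by positivity) (by omega))
  have hle := hS.card_le_of_ediam_le_two (Order.le_of_lt_add_one (by norm_num; exact h))
  rw [hcard, hdeg] at hle
  rw [← hqF] at hc
  generalize minCyclicDegree (q - 1) = c at hle hc
  -- Since c ≤ q - 4, the degree plus one is at most 3q - 6, while q²(q-1) > (3q-6)² for q = 8 + k.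
  obtain ⟨k, rfl⟩ := Nat.exists_eq_add_of_le hq8
  have hc' : c ≤ k + 4 := by omega
  have h3 : (8 + k) ^ 2 * (k + 7) ≤ (3 * k + 18) ^ 2 := by
    refine (le_of_eq ?_).trans (hle.trans (Nat.pow_le_pow_left (by omega) 2))
    rw [show 8 + k - 1 = k + 7 by omega]
  nlinarith [sq_nonneg k, Nat.zero_le (k ^ 3)]
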